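/- For a distribution $\mathcal D$ on $[0,\infty)$ with c.d.f. $F$ and density $f$, let $\mathcal D_{n:n}$ be the maximum of $n$ i.i.d. draws from $\mathcal D$; $\mathcal D$ is MHR if $(1-F)/f$ is non-increasing. For $\boldsymbol\sigma\in\mathbb R_{\ge0}^n$ let $X_1,\dots,X_n\sim\mathcal D$ be rewards of $n$ boxes and $Y_i=X_i+\epsilon_i$ the observations, where $\epsilon_i\sim\mathcal N(0,\sigma_i^2)$ and all $X_i,\epsilon_i$ are independent. A policy $A$ maps $(\boldsymbol\sigma,\boldsymbol y)$ to a probability distribution over the boxes; $R_A(\mathcal D,\boldsymbol\sigma)$ is the expected reward $X_i$ of the box $i$ it chooses after observing $\boldsymbol y=(Y_1,\dots,Y_n)$. The optimal clairvoyant policy (which knows $\mathcal D$) selects a box with maximal posterior mean $\mathbb E[X_i\mid Y_i=y_i]$, and its reward is $R_{\mathsf{Opt}_{\mathcal D}}(\mathcal D,\boldsymbol\sigma)=\mathbb E_{\boldsymbol y}\big[\max_i\mathbb E[X_i\mid Y_i=y_i]\big]$. The prophet's reward is $\mathbb E[\mathcal D_{n:n}]$. For $c\in(0,1]$ the medium-noise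 set $\mathcal M_{n,c}$ consists of the $\boldsymbol\sigma\in\mathbb R_{\ge 0}^n$ with $$\sigma_1\le\dots\le\sigma_n\quad\text{and}\quad \sigma_{\lceil n^c\rceil}>\frac{\mathbb E[\mathcal D_{k:k}]}{18\,c\sqrt{2\ln n}},\qquad k=\lfloor n^c\rfloor .$$ **Theorem.** Let $\mathcal D=|\mathcal N(0,1)|$ be the half-normal distribution. 1. $\mathcal D$ is MHR, and $\mathbb E[\mathcal D_{k:k}]\in\omega(\mathbb E[\mathcal D])$ as $k\to\infty$. 2. $R_A(\mathcal D,\boldsymbol\sigma)\le R_{\mathsf{Opt}_{\mathcal D}}(\mathcal D,\boldsymbol\sigma)$ for all $n$, all $\boldsymbol\sigma\in\mathbb R_{\ge0}^n$ and every policy $A$. 3. There are absolute constants $C$ and $n_0$ such that for all $n\ge n_0$, all $c\in\big[\frac1{400\sqrt{\ln n}},1\big]$ and all $\boldsymbol\sigma\in\mathcal M_{n,c}$, $$R_{\mathsf{Opt}_{\mathcal D}}(\mathcal D,\boldsymbol\sigma)\le C\,\sqrt c\;\mathbb E[\mathcal D_{n:n}].$$ 4. Consequently no policy is a constant approximation to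 the prophet: for every $\alpha>0$ and all sufficiently large $n$ there is $c\in\big[\frac1{400\sqrt{\ln n}},1\big]$ such that $\mathcal M_{n,c}\neq\emptyset$ and $R_A(\mathcal D,\boldsymbol\sigma)<\alpha\,\mathbb E[\mathcal D_{n:n}]$ for every $\boldsymbol\sigma\in\mathcal M_{n,c}$ and every policy $A$. -/

import Mathlib

open MeasureTheory ProbabilityTheory Filter Asymptotics
open scoped NNReal ENNReal

namespace NoisyBoxes

/-- The half-normal distribution, i.e. the law of `|Z|` for a standard normal `Z`. -/
noncomputable def halfNormal : Measure ℝ := (gaussianReal 0 1).map (fun x => |x|)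

/-- `D` is a probability distribution on `[0, ∞)` with a density `f` such that
`(1 - F) / f` is non-increasing, where `1 - F x = D (x, ∞)`. The quotient lives in `[0, ∞]`,
with `a / 0 = ∞` for `a > 0` and `0 / 0 = 0`, so that the zeros of the density to the left of the
support and to its right are treated in the usual way. -/
def IsMHR (D : Measure ℝ) : Prop :=
  IsProbabilityMeasure D ∧ D (Set.Iio 0) = 0 ∧
    ∃ f : ℝ → ℝ≥0, Measurable f ∧ D = volume.withDensity (fun x => (f x : ℝ≥0∞)) ∧
      Antitone (fun x => D (Set.Ioi x) / (f x : ℝ≥0∞))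

/-- `E[D_{n:n}]`, the expected maximum of `n` i.i.d. draws from `D`: the reward of the prophet. -/
noncomputable def expMax (D : Measure ℝ) (n : ℕ) : ℝ :=
  ∫ x : Fin n → ℝ, ⨆ i, x i ∂(Measure.pi fun _ => D)

/-- The joint law of the pairs `(X_i, ε_i)`, all independent, where the reward `X_i` has law `D`
and the noise `ε_i` is centred normal with standard deviation `σ i`. -/
noncomputable def boxLaw (D : Measure ℝ) {n : ℕ} (σ : Fin n → ℝ≥0) :
    Measure (Fin n → ℝ × ℝ) :=
  Measure.pi fun i => D.prod (gaussianReal 0 (σ i ^ 2))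

/-- The reward `X_i`. -/
def reward {n : ℕ} (i : Fin n) (ω : Fin n → ℝ × ℝ) : ℝ := (ω i).1

/-- The observation `Y_i = X_i + ε_i`. -/
def obs {n : ℕ} (i : Fin n) (ω : Fin n → ℝ × ℝ) : ℝ := (ω i).1 + (ω i).2

/-- A (randomized) policy: it maps noise levels `σ` and observations `y` to a probability
distribution over the boxes, measurably in `y`. -/
structure Policy (n : ℕ) where
  /-- The probability of choosing box `i` given `σ` and `y`. -/
  prob : (Fin n → ℝ≥0) → (Fin n → ℝ) → Fin n → ℝ
  prob_nonneg : ∀ σ y i, 0 ≤ prob σ y i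
  prob_sum : ∀ σ y, ∑ i, prob σ y i = 1
  measurable_prob : ∀ σ i, Measurable fun y => prob σ y i

/-- `R_A(D, σ)`, the expected reward of the policy `A`. -/
noncomputable def policyReward (D : Measure ℝ) {n : ℕ} (σ : Fin n → ℝ≥0) (A : Policy n) : ℝ :=
  ∫ ω, ∑ i, A.prob σ (fun j => obs j ω) i * reward i ω ∂(boxLaw D σ)

/-- `E[X_i | Y_i]`, the posterior mean of the `i`-th reward given the `i`-th observation. -/
noncomputable def posteriorMean (D : Measure ℝ) {n : ℕ} (σ : Fin n → ℝ≥0) (i : Fin n) :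
    (Fin n → ℝ × ℝ) → ℝ :=
  (boxLaw D σ)[reward i | MeasurableSpace.comap (obs i) inferInstance]

/-- The expected reward of the optimal clairvoyant policy, which knows `D` and selects
a box with the largest posterior mean: `E_y[max_i E[X_i | Y_i = y_i]]`. -/
noncomputable def optReward (D : Measure ℝ) {n : ℕ} (σ : Fin n → ℝ≥0) : ℝ :=
  ∫ ω, ⨆ i, posteriorMean D σ i ω ∂(boxLaw D σ)

/-- Medium noise: `σ_1 ≤ … ≤ σ_n` and `σ_{n^c} > E[D_{n^c:n^c}] / (18 c √(2 ln n))`.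
When `n ^ c` is not an integer the index on the left is rounded up and the
number of samples on the right is rounded down. For sorted `σ` this is implied by the condition
in which both are rounded up, and by the one in which both are rounded down.
Box number `k` is the element `k - 1` of `Fin n`. -/
def mediumNoise (D : Measure ℝ) (n : ℕ) (c : ℝ) : Set (Fin n → ℝ≥0) :=
  {σ | Monotone σ ∧ ∃ i : Fin n, (i : ℕ) + 1 = ⌈(n : ℝ) ^ c⌉₊ ∧
    expMax D ⌊(n : ℝ) ^ c⌋₊ / (18 * c * √(2 * Real.log n)) < (σ i : ℝ)}

end NoisyBoxes

namespace NoisyBoxes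

/-! Write `L = log n`. The prophet earns at least order `√L`: the largest of `n` half-normals
exceeds `√L - 1` with probability at least `1/2` (`sqrt_log_le_expMax`).

The clairvoyant reward is split at the threshold index of the medium-noise condition. Fewer than `n
^ c` boxes come before it. Even with noiseless observations, their best reward is only of order `√(c
L)`, by a union bound over the excesses `(X - t)⁺` at `t = √(2 c L)`.

The later boxes have noise at least `s`. Given `Y = y`, a half-normal reward with noise variance `v`
is a normal variable of mean `y / (v + 1)` and variance `v / (v + 1) ≤ 1`, truncated to `(0, ∞)`;
hence its posterior mean is at most `y⁺ / (v + 1) + 1` (`posteriorMean_ae_le_posteriorBound`).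
Rewards and normalised noises are uniformly of order `√L`, so these posterior means are of order `√L
/ s + 1`. Medium noise and `E[D_{k:k}] ≳ √(c L)` give `1 / s ≲ √c`, so both groups contribute `O(√c
√L)`. These estimates meet in `optReward_le` and `optReward_le_of_mem_mediumNoise`.

That no policy beats the clairvoyant one is Fubini over the other boxes plus the pull-out property
of conditional expectation (`integral_mul_reward`). Taking `c` as small as allowed then sends the
ratio to the prophet to zero. -/

instance isProbabilityMeasure_halfNormal : IsProbabilityMeasure halfNormal :=
  Measure.isProbabilityMeasure_map (by fun_prop)

/-! ### Density and hazard rate of the half-normal law. -/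

theorem lintegral_halfNormal {g : ℝ → ℝ≥0∞} (hg : Measurable g) :
    ∫⁻ x, g x ∂halfNormal
      = ∫⁻ x in Set.Ioi 0, ENNReal.ofReal (2 * gaussianPDFReal 0 1 x) * g x := by
  have hsplit : ∫⁻ x, g x ∂halfNormal = ∫⁻ x, gaussianPDF 0 1 x * g |x| := by
    rw [halfNormal, lintegral_map hg (by fun_prop),
      gaussianReal_of_var_ne_zero 0 one_ne_zero,
      lintegral_withDensity_eq_lintegral_mul _ (by fun_prop) (by fun_prop)]
    rfl
  have hpos : ∫⁻ x in Set.Ioi 0, gaussianPDF 0 1 x * g |x|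
      = ∫⁻ x in Set.Ioi 0, gaussianPDF 0 1 x * g x :=
    setLIntegral_congr_fun measurableSet_Ioi fun x hx => by
      simp only [abs_of_pos (show (0 : ℝ) < x from hx)]
  have hneg : ∫⁻ x in Set.Iic 0, gaussianPDF 0 1 x * g |x|
      = ∫⁻ x in Set.Ioi 0, gaussianPDF 0 1 x * g |x| := by
    rw [setLIntegral_congr Ioi_ae_eq_Ici,
      ← (Measure.measurePreserving_neg (volume : Measure ℝ)).setLIntegral_comp_preimage_emb
        (MeasurableEquiv.neg ℝ).measurableEmbedding]
    have : (Neg.neg ⁻¹' Set.Iic (0 : ℝ)) = Set.Ici 0 := by ext; simp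
    rw [this]
    refine lintegral_congr fun x => ?_
    simp [gaussianPDF, gaussianPDFReal]
  rw [hsplit, ← lintegral_add_compl _ (measurableSet_Ioi (a := (0 : ℝ))), Set.compl_Ioi, hneg, hpos,
    ← lintegral_add_left (by fun_prop)]
  refine lintegral_congr fun x => ?_
  rw [← two_mul, ← mul_assoc, gaussianPDF, ENNReal.ofReal_mul zero_le_two, ENNReal.ofReal_ofNat]

/-- The density of the half-normal distribution. -/
noncomputable def halfNormalPDF (x : ℝ) : ℝ≥0 :=
  if 0 ≤ x then (2 * gaussianPDFReal 0 1 x).toNNReal else 0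

theorem measurable_halfNormalPDF : Measurable halfNormalPDF :=
  Measurable.ite measurableSet_Ici (by fun_prop) measurable_const

theorem halfNormal_eq_withDensity :
    halfNormal = volume.withDensity (fun x => (halfNormalPDF x : ℝ≥0∞)) := by
  ext s hs
  rw [← lintegral_indicator_one hs, lintegral_halfNormal (measurable_one.indicator hs),
    withDensity_apply _ hs, setLIntegral_congr Ioi_ae_eq_Ici,
    ← lintegral_indicator measurableSet_Ici, ← lintegral_indicator hs]
  refine lintegral_congr fun x => ?_
  by_cases hx : 0 ≤ x <;> by_cases hxs : x ∈ s <;>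
    simp [Set.indicator, halfNormalPDF, hx, hxs, ENNReal.ofReal]

theorem halfNormal_Iio : halfNormal (Set.Iio 0) = 0 := by
  rw [halfNormal, Measure.map_apply (by fun_prop) measurableSet_Iio]
  convert measure_empty (μ := gaussianReal 0 1)
  ext x; simp

theorem halfNormal_ae_nonneg : ∀ᵐ x ∂halfNormal, 0 ≤ x := by
  have h := halfNormal_Iio
  rw [ae_iff]
  convert h using 2
  ext; simp

/-- After the shift `x = y + u` the factor `exp (-y ^ 2 / 2)` cancels. The remaining integrand is
pointwise decreasing in `y`, which makes the MHR property visible on `[0, ∞)`. -/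
theorem halfNormal_Ioi_div {y : ℝ} (hy : 0 ≤ y) :
    halfNormal (Set.Ioi y) / (halfNormalPDF y : ℝ≥0∞)
      = ∫⁻ u in Set.Ioi 0, ENNReal.ofReal (Real.exp (-u ^ 2 / 2 - y * u)) := by
  have hpos : 0 < 2 * gaussianPDFReal 0 1 y :=
    mul_pos two_pos (gaussianPDFReal_pos 0 1 y one_ne_zero)
  have hpdf : (halfNormalPDF y : ℝ≥0∞) = ENNReal.ofReal (2 * gaussianPDFReal 0 1 y) := by
    simp [halfNormalPDF, hy, ENNReal.ofReal]
  have hpre : (fun u => y + u) ⁻¹' Set.Ioi y = Set.Ioi (0 : ℝ) := by ext; simp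
  rw [halfNormal_eq_withDensity, withDensity_apply _ measurableSet_Ioi,
    ← (measurePreserving_add_left (volume : Measure ℝ) y).setLIntegral_comp_preimage_emb
      (MeasurableEquiv.addLeft y).measurableEmbedding, hpre, div_eq_mul_inv,
    ← lintegral_mul_const' _ _ (by
      rw [hpdf, Ne, ENNReal.inv_eq_top, ENNReal.ofReal_eq_zero]; exact hpos.not_ge)]
  refine setLIntegral_congr_fun measurableSet_Ioi fun u hu => ?_
  have hu : 0 < u := hu
  have hyu : 0 ≤ y + u := by positivity
  simp only [hpdf]
  rw [← div_eq_mul_inv]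
  have : (halfNormalPDF (y + u) : ℝ≥0∞)
      = ENNReal.ofReal (2 * gaussianPDFReal 0 1 (y + u)) := by
    simp [halfNormalPDF, hyu, ENNReal.ofReal]
  rw [this, ← ENNReal.ofReal_div_of_pos hpos]
  congr 1
  rw [div_eq_iff hpos.ne', gaussianPDFReal, gaussianPDFReal]
  have : Real.exp (-(y + u - 0) ^ 2 / (2 * ((1 : ℝ≥0) : ℝ)))
      = Real.exp (-u ^ 2 / 2 - y * u) * Real.exp (-(y - 0) ^ 2 / (2 * ((1 : ℝ≥0) : ℝ))) := by
    rw [← Real.exp_add]; congr 1; simp; ring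
  rw [this]; ring

theorem isMHR_halfNormal : IsMHR halfNormal := by
  refine ⟨inferInstance, halfNormal_Iio, halfNormalPDF, measurable_halfNormalPDF,
    halfNormal_eq_withDensity, fun x y hxy => ?_⟩
  rcases lt_or_ge x 0 with hx | hx
  -- Left of the support the quotient is `1 / 0 = ∞`, so nothing has to be compared.
  · have hne : halfNormal (Set.Ioi x) ≠ 0 := by
      have : halfNormal (Set.Ioi x) = 1 := by
        rw [prob_compl_eq_zero_iff measurableSet_Ioi |>.symm, Set.compl_Ioi]
        exact measure_mono_null (fun z hz => lt_of_le_of_lt hz hx) halfNormal_Iio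
      simp [this]
    have : (halfNormalPDF x : ℝ≥0∞) = 0 := by simp [halfNormalPDF, hx.not_ge]
    simp only [this, ENNReal.div_zero hne, le_top]
  · simp only [halfNormal_Ioi_div hx, halfNormal_Ioi_div (hx.trans hxy)]
    refine setLIntegral_mono (by fun_prop) fun u hu => ENNReal.ofReal_le_ofReal ?_
    have hu : 0 < u := hu
    gcongr

/-! ### Expected excess of a Gaussian over a level. -/

theorem integrable_exp_mul_abs_gaussianReal (t : ℝ) :
    Integrable (fun z => Real.exp (t * |z|)) (gaussianReal 0 1) :=
  integrable_exp_mul_abs (integrable_exp_mul_gaussianReal t)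
    (by simpa using integrable_exp_mul_gaussianReal (μ := 0) (v := 1) (-t))

theorem integral_exp_mul_abs_gaussianReal_le (t : ℝ) :
    ∫ z, Real.exp (t * |z|) ∂gaussianReal 0 1 ≤ 2 * Real.exp (t ^ 2 / 2) := by
  have hm : ∀ s : ℝ, ∫ z, Real.exp (s * z) ∂gaussianReal 0 1 = Real.exp (s ^ 2 / 2) := by
    intro s
    have := congrFun (mgf_id_gaussianReal (μ := 0) (v := 1)) s
    simpa [mgf] using this
  calc ∫ z, Real.exp (t * |z|) ∂gaussianReal 0 1
      ≤ ∫ z, (Real.exp (t * z) + Real.exp (-t * z)) ∂gaussianReal 0 1 := by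
        refine integral_mono (integrable_exp_mul_abs_gaussianReal t)
          ((integrable_exp_mul_gaussianReal t).add (integrable_exp_mul_gaussianReal (-t)))
          fun z => ?_
        rcases abs_choice z with h | h <;> simp only [h]
        · linarith [Real.exp_pos (-t * z)]
        · have : t * -z = -t * z := by ring
          rw [this]; linarith [Real.exp_pos (t * z)]
    _ = 2 * Real.exp (t ^ 2 / 2) := by
        rw [integral_add (integrable_exp_mul_gaussianReal t) (integrable_exp_mul_gaussianReal (-t)),
          hm, hm, neg_sq]; ring

theorem integrable_abs_gaussianReal (v : ℝ≥0) : Integrable (fun z => |z|) (gaussianReal 0 v) := by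
  have := (memLp_id_gaussianReal (μ := 0) (v := v) 1).integrable (by simp)
  exact this.abs

theorem integrable_excess_gaussianReal (t : ℝ) :
    Integrable (fun z => max (|z| - t) 0) (gaussianReal 0 1) :=
  ((integrable_abs_gaussianReal 1).sub (integrable_const t)).pos_part

/-- Chernoff bound: with `u = t (|z| - t)` one has `u ≤ exp (u - 1) ≤ exp u / 2`, and `t ≥ 1` lets
`u` dominate a positive excess. The `1/2` cancels the factor `2` from the two tails, so the final
bound has constant one. -/
theorem integral_excess_gaussianReal_le {t : ℝ} (ht : 1 ≤ t) :
    ∫ z, max (|z| - t) 0 ∂gaussianReal 0 1 ≤ Real.exp (-t ^ 2 / 2) := by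
  have ht0 : 0 < t := by linarith
  have hpt : ∀ z : ℝ, max (|z| - t) 0 ≤ Real.exp (-t ^ 2) / 2 * Real.exp (t * |z|) := by
    intro z
    refine max_le ?_ (by positivity)
    have h1 : t * (|z| - t) ≤ Real.exp (t * (|z| - t) - 1) := by
      linarith [Real.add_one_le_exp (t * (|z| - t) - 1)]
    have h2 : Real.exp (t * (|z| - t) - 1) ≤ Real.exp (t * (|z| - t)) / 2 := by
      rw [Real.exp_sub]
      have : 2 ≤ Real.exp 1 := by linarith [Real.add_one_le_exp (1 : ℝ)]
      gcongr
    have h3 : Real.exp (-t ^ 2) / 2 * Real.exp (t * |z|) = Real.exp (t * (|z| - t)) / 2 := by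
      rw [div_mul_eq_mul_div, ← Real.exp_add]; congr 2; ring
    rw [h3]
    rcases le_total (|z| - t) 0 with h | h
    · exact h.trans (by positivity)
    · nlinarith
  calc ∫ z, max (|z| - t) 0 ∂gaussianReal 0 1
      ≤ ∫ z, Real.exp (-t ^ 2) / 2 * Real.exp (t * |z|) ∂gaussianReal 0 1 :=
        integral_mono (integrable_excess_gaussianReal t)
          ((integrable_exp_mul_abs_gaussianReal t).const_mul _) hpt
    _ ≤ Real.exp (-t ^ 2) / 2 * (2 * Real.exp (t ^ 2 / 2)) := by
        rw [integral_const_mul]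
        gcongr
        exact integral_exp_mul_abs_gaussianReal_le t
    _ = Real.exp (-t ^ 2 / 2) := by
        rw [div_mul_eq_mul_div, mul_left_comm, mul_div_cancel_left₀ _ two_ne_zero, ← Real.exp_add]
        congr 1; ring

theorem integrable_id_halfNormal : Integrable (fun x => x) halfNormal := by
  rw [halfNormal, integrable_map_measure (by fun_prop) (by fun_prop)]
  exact integrable_abs_gaussianReal 1

theorem integral_excess_halfNormal_le {t : ℝ} (ht : 1 ≤ t) :
    ∫ x, max (x - t) 0 ∂halfNormal ≤ Real.exp (-t ^ 2 / 2) := by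
  rw [halfNormal, integral_map (by fun_prop) (by fun_prop)]
  exact integral_excess_gaussianReal_le ht

/-! ### Mean of a truncated normal distribution. -/

theorem exp_quadratic_eq {p : ℝ} (hp : 0 < p) (r x : ℝ) :
    Real.exp (-p * x ^ 2 / 2 + r * x)
      = Real.exp (r ^ 2 / (2 * p)) * Real.exp (-(p / 2) * (x - r / p) ^ 2) := by
  rw [← Real.exp_add]; congr 1; field_simp; ring

theorem integrable_exp_quadratic {p : ℝ} (hp : 0 < p) (r : ℝ) :
    Integrable (fun x : ℝ => Real.exp (-p * x ^ 2 / 2 + r * x)) := by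
  simp_rw [exp_quadratic_eq hp]
  exact ((integrable_exp_neg_mul_sq (half_pos hp)).comp_sub_right (r / p)).const_mul _

theorem integrable_mul_exp_quadratic {p : ℝ} (hp : 0 < p) (r : ℝ) :
    Integrable (fun x : ℝ => x * Real.exp (-p * x ^ 2 / 2 + r * x)) := by
  have h1 := ((integrable_mul_exp_neg_mul_sq (half_pos hp)).comp_sub_right (r / p)).const_mul
    (Real.exp (r ^ 2 / (2 * p)))
  have h2 := (integrable_exp_quadratic hp r).const_mul (r / p)
  refine (h1.add h2).congr (ae_of_all _ fun x => ?_)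
  simp only [Pi.add_apply, exp_quadratic_eq hp]
  ring

/-- The integrand is the derivative of `-exp (-p x ^ 2 / 2 + r x)`, which runs from `-1` to `0`.
This ties the first moment to the normalising constant. -/
theorem integral_Ioi_sub_mul_exp_quadratic {p : ℝ} (hp : 0 < p) (r : ℝ) :
    ∫ x in Set.Ioi (0 : ℝ), (p * x - r) * Real.exp (-p * x ^ 2 / 2 + r * x) = 1 := by
  have hd : ∀ x : ℝ, HasDerivAt (fun x => -Real.exp (-p * x ^ 2 / 2 + r * x))
      ((p * x - r) * Real.exp (-p * x ^ 2 / 2 + r * x)) x := by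
    intro x
    have h : HasDerivAt (fun x : ℝ => -p * x ^ 2 / 2 + r * x) (-p * (2 * x) / 2 + r) x := by
      have := (((hasDerivAt_pow 2 x).const_mul (-p)).div_const 2).add
        ((hasDerivAt_id x).const_mul r)
      exact this.congr_deriv (by simp)
    exact h.exp.neg.congr_deriv (by ring)
  have hi : Integrable (fun x : ℝ => (p * x - r) * Real.exp (-p * x ^ 2 / 2 + r * x)) := by
    refine (((integrable_mul_exp_quadratic hp r).const_mul p).sub
      ((integrable_exp_quadratic hp r).const_mul r)).congr (ae_of_all _ fun x => ?_)
    simp only [Pi.sub_apply]; ring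
  have ht : Tendsto (fun x : ℝ => -Real.exp (-p * x ^ 2 / 2 + r * x)) atTop (nhds 0) := by
    rw [← neg_zero]
    refine (Real.tendsto_exp_atBot.comp ?_).neg
    have : (fun x : ℝ => -p * x ^ 2 / 2 + r * x) = fun x => x * (r - p / 2 * x) := by
      ext x; ring
    rw [this]
    refine tendsto_id.atTop_mul_atBot₀ ?_
    exact tendsto_atBot_add_const_left _ r
      (tendsto_neg_atTop_atBot.comp (tendsto_id.const_mul_atTop (half_pos hp)))
  rw [integral_Ioi_of_hasDerivAt_of_tendsto (hd 0).continuousAt.continuousWithinAt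
    (fun x _ => hd x) hi.integrableOn ht]
  simp

/-- The mean of a normal distribution of variance `1 / p ≤ 1`, truncated to `(0, ∞)`. -/
theorem integral_Ioi_mul_exp_quadratic_le {p : ℝ} (hp : 1 ≤ p) (r : ℝ) :
    ∫ x in Set.Ioi (0 : ℝ), x * Real.exp (-p * x ^ 2 / 2 + r * x)
      ≤ (max r 0 / p + 1) * ∫ x in Set.Ioi (0 : ℝ), Real.exp (-p * x ^ 2 / 2 + r * x) := by
  have hp0 : 0 < p := by linarith
  have hI := fun r => (integrable_exp_quadratic hp0 r).integrableOn (s := Set.Ioi 0)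
  have hX := fun r => (integrable_mul_exp_quadratic hp0 r).integrableOn (s := Set.Ioi 0)
  have key : ∀ r, p * ∫ x in Set.Ioi (0 : ℝ), x * Real.exp (-p * x ^ 2 / 2 + r * x)
      = 1 + r * ∫ x in Set.Ioi (0 : ℝ), Real.exp (-p * x ^ 2 / 2 + r * x) := by
    intro r
    rw [← integral_Ioi_sub_mul_exp_quadratic hp0 r, ← integral_const_mul, ← integral_const_mul,
      ← integral_add]
    · congr 1; ext x; ring
    · refine (((hX r).const_mul p).sub ((hI r).const_mul r)).congr (ae_of_all _ fun x => ?_)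
      simp only [Pi.sub_apply]; ring
    · exact (hI r).const_mul r
  -- By `key`, the mean is `r / p + 1 / (p Z)` with `Z` the total mass, so for `r ≥ 0` it suffices
  -- that `p Z ≥ 1`. Dropping `r x` leaves half a Gaussian integral; `p ≥ 1` enters here.
  have hlow : ∀ r, 0 ≤ r → 1 ≤ p * ∫ x in Set.Ioi (0 : ℝ), Real.exp (-p * x ^ 2 / 2 + r * x) := by
    intro r hr
    have h0 : ∫ x in Set.Ioi (0 : ℝ), Real.exp (-(p / 2) * x ^ 2)
        ≤ ∫ x in Set.Ioi (0 : ℝ), Real.exp (-p * x ^ 2 / 2 + r * x) := by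
      refine setIntegral_mono_on (integrable_exp_neg_mul_sq (half_pos hp0)).integrableOn (hI r)
        measurableSet_Ioi fun x hx => Real.exp_le_exp.2 ?_
      have : 0 ≤ r * x := mul_nonneg hr (le_of_lt hx)
      linarith
    rw [integral_gaussian_Ioi] at h0
    have h1 : 2 / p ≤ √(Real.pi / (p / 2)) := by
      refine Real.le_sqrt_of_sq_le ?_
      rw [div_pow, div_div_eq_mul_div, div_le_div_iff₀ (by positivity) hp0]
      nlinarith [Real.pi_gt_three, mul_le_mul_of_nonneg_left hp hp0.le,
        mul_pos hp0 hp0]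
    have h2 : 1 / p ≤ ∫ x in Set.Ioi (0 : ℝ), Real.exp (-p * x ^ 2 / 2 + r * x) := by
      refine le_trans ?_ h0
      rw [le_div_iff₀ two_pos]
      calc 1 / p * 2 = 2 / p := by ring
        _ ≤ _ := h1
    rwa [div_le_iff₀' hp0] at h2
  rcases le_total 0 r with hr | hr
  · rw [max_eq_left hr]
    refine le_of_mul_le_mul_left ?_ hp0
    rw [key r]
    have : p * ((r / p + 1) * ∫ x in Set.Ioi (0 : ℝ), Real.exp (-p * x ^ 2 / 2 + r * x))
        = r * (∫ x in Set.Ioi (0 : ℝ), Real.exp (-p * x ^ 2 / 2 + r * x))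
          + p * ∫ x in Set.Ioi (0 : ℝ), Real.exp (-p * x ^ 2 / 2 + r * x) := by
      field_simp
    rw [this]; linarith [hlow r hr]
  · rw [max_eq_right hr, zero_div, zero_add, one_mul, ← sub_nonpos,
      ← integral_sub (hX r) (hI r)]
    -- For `r ≤ 0` the mean must be shown to be at most `1`. The tilt `exp (r x)` is decreasing, so
    -- `(x - 1) exp (r x) ≤ (x - 1) exp r`, which reduces the claim to `r = 0`.
    have h0 : ∫ x in Set.Ioi (0 : ℝ), (x - 1) * Real.exp (-p * x ^ 2 / 2 + 0 * x) ≤ 0 := by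
      have : (fun x : ℝ => (x - 1) * Real.exp (-p * x ^ 2 / 2 + 0 * x))
        = fun x => x * Real.exp (-p * x ^ 2 / 2 + 0 * x) - Real.exp (-p * x ^ 2 / 2 + 0 * x) := by
        ext x; ring
      rw [this, integral_sub (hX 0) (hI 0), sub_nonpos]
      refine le_of_mul_le_mul_left ?_ hp0
      rw [key 0]
      linarith [hlow 0 le_rfl]
    calc _ ≤ ∫ x in Set.Ioi (0 : ℝ),
          Real.exp r * ((x - 1) * Real.exp (-p * x ^ 2 / 2 + 0 * x)) := by
          refine setIntegral_mono_on ((hX r).sub (hI r)) ?_ measurableSet_Ioi fun x hx => ?_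
          · refine (((hX 0).sub (hI 0)).const_mul (Real.exp r)).congr (ae_of_all _ fun x => ?_)
            simp only [Pi.sub_apply]; ring
          · have e1 : Real.exp (-p * x ^ 2 / 2 + r * x)
                = Real.exp (-p * x ^ 2 / 2) * Real.exp (r * x) := Real.exp_add _ _
            have e2 : (x - 1) * Real.exp (r * x) ≤ (x - 1) * Real.exp r := by
              rcases le_total x 1 with h | h
              · exact mul_le_mul_of_nonpos_left (Real.exp_le_exp.2 (by nlinarith)) (by linarith)
              · exact mul_le_mul_of_nonneg_left (Real.exp_le_exp.2 (by nlinarith)) (by linarith)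
            rw [e1, zero_mul, add_zero]
            have := mul_le_mul_of_nonneg_left e2 (Real.exp_pos (-p * x ^ 2 / 2)).le
            linarith
      _ ≤ 0 := by
          rw [integral_const_mul]
          exact mul_nonpos_of_nonneg_of_nonpos (Real.exp_pos r).le h0

theorem lintegral_Ioi_mul_exp_quadratic_le {p : ℝ} (hp : 1 ≤ p) (r : ℝ) :
    ∫⁻ x in Set.Ioi (0 : ℝ),
        ENNReal.ofReal x * ENNReal.ofReal (Real.exp (-p * x ^ 2 / 2 + r * x))
      ≤ ENNReal.ofReal (max r 0 / p + 1) *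
        ∫⁻ x in Set.Ioi (0 : ℝ), ENNReal.ofReal (Real.exp (-p * x ^ 2 / 2 + r * x)) := by
  have hp0 : 0 < p := by linarith
  have e : ∫⁻ x in Set.Ioi (0 : ℝ),
        ENNReal.ofReal x * ENNReal.ofReal (Real.exp (-p * x ^ 2 / 2 + r * x))
      = ∫⁻ x in Set.Ioi (0 : ℝ), ENNReal.ofReal (x * Real.exp (-p * x ^ 2 / 2 + r * x)) :=
    setLIntegral_congr_fun measurableSet_Ioi fun x hx =>
      (ENNReal.ofReal_mul (le_of_lt hx)).symm
  rw [e, ← ofReal_integral_eq_lintegral_ofReal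
      (integrable_mul_exp_quadratic hp0 r).integrableOn
      (ae_restrict_of_forall_mem measurableSet_Ioi fun x hx =>
        mul_nonneg (le_of_lt hx) (Real.exp_pos _).le),
    ← ofReal_integral_eq_lintegral_ofReal (integrable_exp_quadratic hp0 r).integrableOn
      (ae_of_all _ fun x => (Real.exp_pos _).le),
    ← ENNReal.ofReal_mul (by positivity)]
  exact ENNReal.ofReal_le_ofReal (integral_Ioi_mul_exp_quadratic_le hp r)

/-! ### Lower bounds for the expected maximum. -/

theorem integrable_iSup_of_forall {Ω ι : Type*} [Fintype ι] [MeasurableSpace Ω] {μ : Measure Ω}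
    {f : ι → Ω → ℝ} (hf : ∀ i, Integrable (f i) μ) :
    Integrable (fun ω => ⨆ i, f i ω) μ := by
  refine (integrable_finsetSum Finset.univ fun i _ => (hf i).abs).mono'
    (AEMeasurable.iSup fun i => (hf i).aemeasurable).aestronglyMeasurable
    (ae_of_all _ fun ω => ?_)
  rcases isEmpty_or_nonempty ι with h | h
  · simp
  · have hle : ∀ i, |f i ω| ≤ ∑ j, |f j ω| := fun i =>
      Finset.single_le_sum (f := fun j => |f j ω|) (fun j _ => abs_nonneg _) (Finset.mem_univ i)
    rw [Real.norm_eq_abs, abs_le]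
    refine ⟨?_, ciSup_le fun i => (le_abs_self _).trans (hle i)⟩
    obtain ⟨i⟩ := h
    refine le_trans ?_ (le_ciSup (f := fun i => f i ω) (Set.finite_range _).bddAbove i)
    linarith [neg_abs_le (f i ω), hle i]

/-- The upper tail contains `[t, t + 1]`, where the decreasing Gaussian density is smallest at the
right end. -/
theorem halfNormal_real_Iio_le {t : ℝ} (ht : 0 ≤ t) :
    halfNormal.real (Set.Iio t) ≤ 1 - gaussianPDFReal 0 1 (t + 1) := by
  have hc : halfNormal.real (Set.Iio t) = 1 - halfNormal.real (Set.Ici t) := by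
    rw [← Set.compl_Iio, probReal_compl_eq_one_sub measurableSet_Iio]; ring
  have hlow : ENNReal.ofReal (gaussianPDFReal 0 1 (t + 1)) ≤ halfNormal (Set.Ici t) := by
    rw [halfNormal, Measure.map_apply (by fun_prop) measurableSet_Ici,
      gaussianReal_apply 0 one_ne_zero]
    calc ENNReal.ofReal (gaussianPDFReal 0 1 (t + 1))
        = ∫⁻ _ in Set.Icc t (t + 1), ENNReal.ofReal (gaussianPDFReal 0 1 (t + 1)) := by simp
      _ ≤ ∫⁻ x in Set.Icc t (t + 1), gaussianPDF 0 1 x := by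
          refine setLIntegral_mono (by fun_prop) fun x hx => ENNReal.ofReal_le_ofReal ?_
          have h0 : 0 ≤ x := ht.trans hx.1
          simp only [gaussianPDFReal, sub_zero]
          gcongr
          exact hx.2
      _ ≤ _ := lintegral_mono_set fun x hx => hx.1.trans (le_abs_self x)
  have := (ENNReal.ofReal_le_iff_le_toReal (measure_ne_top _ _)).1 hlow
  rw [hc, measureReal_def]
  linarith

/-- Markov's inequality for the maximum, which stays below `t` exactly when all independent draws
do. -/
theorem mul_one_sub_pow_le_expMax {n : ℕ} (hn : 0 < n) (t : ℝ) :
    t * (1 - halfNormal.real (Set.Iio t) ^ n) ≤ expMax halfNormal n := by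
  have : Nonempty (Fin n) := ⟨⟨0, hn⟩⟩
  set μ : Measure (Fin n → ℝ) := Measure.pi fun _ => halfNormal
  have hmp := measurePreserving_eval (fun _ : Fin n => halfNormal)
  have hint : Integrable (fun x : Fin n → ℝ => ⨆ i, x i) μ :=
    integrable_iSup_of_forall fun i => (hmp i).integrable_comp_of_integrable integrable_id_halfNormal
  have hnn : ∀ᵐ x ∂μ, 0 ≤ ⨆ i, x i := by
    have := (hmp ⟨0, hn⟩).quasiMeasurePreserving.ae halfNormal_ae_nonneg
    filter_upwards [this] with x hx
    exact le_trans hx (le_ciSup (f := x) (Set.finite_range _).bddAbove ⟨0, hn⟩)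
  have hset : (Set.univ.pi fun _ : Fin n => Set.Iio t)ᶜ ⊆ {x : Fin n → ℝ | t ≤ ⨆ i, x i} := by
    intro x hx
    simp only [Set.mem_compl_iff, Set.mem_univ_pi, Set.mem_Iio, not_forall, not_lt] at hx
    obtain ⟨i, hi⟩ := hx
    exact hi.trans (le_ciSup (Set.finite_range _).bddAbove i)
  have hprob : μ.real (Set.univ.pi fun _ : Fin n => Set.Iio t)ᶜ
      = 1 - halfNormal.real (Set.Iio t) ^ n := by
    rw [probReal_compl_eq_one_sub (MeasurableSet.univ_pi fun _ => measurableSet_Iio),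
      measureReal_def, Measure.pi_pi]
    simp [measureReal_def]
  rcases le_total 0 t with ht | ht
  · calc t * (1 - halfNormal.real (Set.Iio t) ^ n) ≤ t * μ.real {x : Fin n → ℝ | t ≤ ⨆ i, x i} := by
          rw [← hprob]
          exact mul_le_mul_of_nonneg_left (measureReal_mono hset) ht
      _ ≤ _ := mul_meas_ge_le_integral_of_nonneg hnn hint t
  · refine le_trans (mul_nonpos_of_nonpos_of_nonneg ht ?_) (integral_nonneg_of_ae hnn)
    rw [← hprob]; exact measureReal_nonneg

theorem sqrt_log_le_expMax {n : ℕ} (hn : 100 ≤ n) :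
    √(Real.log n) / 4 ≤ expMax halfNormal n := by
  have hnR : (100 : ℝ) ≤ n := by exact_mod_cast hn
  have hn0 : (0 : ℝ) < n := by linarith
  have hlog : 4 ≤ Real.log n := by
    rw [Real.le_log_iff_exp_le hn0]
    have : Real.exp 4 = Real.exp 1 ^ 4 := by rw [← Real.exp_nat_mul]; norm_num
    rw [this]
    have : Real.exp 1 ^ 4 ≤ (2.72 : ℝ) ^ 4 := by
      gcongr; linarith [Real.exp_one_lt_d9]
    norm_num at this ⊢; linarith
  have hs : 2 ≤ √(Real.log n) := Real.le_sqrt_of_sq_le (by linarith)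
  -- At `t + 1 = √(log n)` the Gaussian density is `1 / √(2 π n)`, which is at least `1 / n` for `n
  -- ≥ 100`. So all draws stay below `t` with probability at most `(1 - 1 / n) ^ n ≤ 1 / e`.
  set t := √(Real.log n) - 1 with ht
  have hpdf : 1 / (n : ℝ) ≤ gaussianPDFReal 0 1 (t + 1) := by
    have h1 : Real.exp (-(t + 1 - 0) ^ 2 / (2 * ((1 : ℝ≥0) : ℝ))) = (√n)⁻¹ := by
      rw [show -(t + 1 - 0) ^ 2 / (2 * ((1 : ℝ≥0) : ℝ)) = -(Real.log n / 2) by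
        rw [ht]; simp; rw [Real.sq_sqrt (by linarith)]; ring, Real.exp_neg, Real.sqrt_eq_rpow,
        Real.rpow_def_of_pos hn0]
      congr 2; ring
    rw [gaussianPDFReal, h1]
    have h2 : √(2 * Real.pi * ((1 : ℝ≥0) : ℝ)) ≤ 10 := by
      refine Real.sqrt_le_iff.2 ⟨by norm_num, ?_⟩
      norm_num; linarith [Real.pi_lt_four]
    have h3 : 10 ≤ √(n : ℝ) := Real.le_sqrt_of_sq_le (by linarith)
    rw [← mul_inv, one_div]
    refine inv_anti₀ (by positivity) ?_
    calc √(2 * Real.pi * ((1 : ℝ≥0) : ℝ)) * √n ≤ √n * √n :=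
          mul_le_mul_of_nonneg_right (h2.trans h3) (Real.sqrt_nonneg _)
      _ = n := Real.mul_self_sqrt hn0.le
  have hp : halfNormal.real (Set.Iio t) ^ n ≤ 1 / 2 := by
    calc halfNormal.real (Set.Iio t) ^ n ≤ (Real.exp (-(1 / n))) ^ n := by
          refine pow_le_pow_left₀ measureReal_nonneg ?_ n
          have := halfNormal_real_Iio_le (t := t) (by rw [ht]; linarith)
          linarith [Real.add_one_le_exp (-(1 / (n : ℝ)))]
      _ = (Real.exp 1)⁻¹ := by
          rw [← Real.exp_nat_mul, ← Real.exp_neg]; congr 1; field_simp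
      _ ≤ 1 / 2 := by
          rw [one_div]
          exact inv_anti₀ two_pos (by linarith [Real.add_one_le_exp (1 : ℝ)])
  refine le_trans ?_ (mul_one_sub_pow_le_expMax (by lia) t)
  have : t * (1 / 2) ≤ t * (1 - halfNormal.real (Set.Iio t) ^ n) := by
    refine mul_le_mul_of_nonneg_left (by linarith) (by rw [ht]; linarith)
  refine le_trans ?_ this
  rw [ht]; linarith

theorem tendsto_expMax_halfNormal : Tendsto (expMax halfNormal) atTop atTop := by
  have h : Tendsto (fun n : ℕ => √(Real.log n) / 4) atTop atTop :=
    (Real.tendsto_sqrt_atTop.comp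
      (Real.tendsto_log_atTop.comp tendsto_natCast_atTop_atTop)).atTop_div_const (by norm_num)
  refine tendsto_atTop_mono' _ ?_ h
  filter_upwards [eventually_ge_atTop 100] with n hn using sqrt_log_le_expMax hn

theorem isLittleO_expMax_halfNormal :
    (fun _ : ℕ => ∫ x, x ∂halfNormal) =o[atTop] fun k : ℕ => expMax halfNormal k :=
  isLittleO_const_left.2 (Or.inr (tendsto_norm_atTop_atTop.comp tendsto_expMax_halfNormal))

/-! ### Posterior of a half-normal reward under Gaussian noise. -/

/-- Disintegration of the joint law of `(X, X + ε)` along the observation. -/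
theorem lintegral_halfNormal_prod {v : ℝ≥0} (hv : v ≠ 0) {h : ℝ × ℝ → ℝ≥0∞} (hh : Measurable h) :
    ∫⁻ ω, h (ω.1, ω.1 + ω.2) ∂(halfNormal.prod (gaussianReal 0 v))
      = ∫⁻ y, ∫⁻ x in Set.Ioi 0,
          ENNReal.ofReal (2 * gaussianPDFReal 0 1 x) * (gaussianPDF x v y * h (x, y)) := by
  have hpdf : Measurable fun z : ℝ × ℝ => gaussianPDF z.1 v z.2 := by
    unfold gaussianPDF gaussianPDFReal; fun_prop
  have hm : Measurable fun z : ℝ × ℝ => gaussianPDF z.1 v z.2 * h z := hpdf.mul hh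
  have hinner : ∀ x : ℝ, ∫⁻ e, h (x, x + e) ∂gaussianReal 0 v
      = ∫⁻ y, gaussianPDF x v y * h (x, y) := by
    intro x
    have h1 : gaussianReal x v = (gaussianReal 0 v).map (fun e => x + e) := by
      rw [gaussianReal_map_const_add, zero_add]
    rw [← lintegral_map (μ := gaussianReal 0 v) (f := fun y => h (x, y)) (g := fun e => x + e)
      (by fun_prop) (by fun_prop), ← h1, gaussianReal_of_var_ne_zero x hv,
      lintegral_withDensity_eq_lintegral_mul _ (by fun_prop) (by fun_prop)]
    rfl
  rw [lintegral_prod _ (by fun_prop)]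
  simp_rw [hinner]
  rw [lintegral_halfNormal hm.lintegral_prod_right', lintegral_lintegral_swap]
  · refine lintegral_congr fun x => (lintegral_const_mul _ ?_).symm
    exact hm.comp measurable_prodMk_left
  · exact ((by fun_prop : Measurable fun z : ℝ × ℝ =>
      ENNReal.ofReal (2 * gaussianPDFReal 0 1 z.1)).mul hm).comp measurable_swap |>.aemeasurable

/-- An upper bound for `E[X | X + ε = y]` if `X` is half-normal and `ε` has variance `v`. -/
noncomputable def posteriorBound (v : ℝ≥0) (y : ℝ) : ℝ := max y 0 / (v + 1) + 1

theorem posteriorBound_nonneg (v : ℝ≥0) (y : ℝ) : 0 ≤ posteriorBound v y := by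
  unfold posteriorBound; positivity

@[fun_prop]
theorem measurable_posteriorBound (v : ℝ≥0) : Measurable (posteriorBound v) := by
  unfold posteriorBound; fun_prop

theorem two_mul_gaussianPDFReal_mul {v : ℝ≥0} (hv : v ≠ 0) (x y : ℝ) :
    2 * gaussianPDFReal 0 1 x * gaussianPDFReal x v y
      = 2 * (√(2 * Real.pi))⁻¹ * (√(2 * Real.pi * v))⁻¹ * Real.exp (-y ^ 2 / (2 * v))
        * Real.exp (-(1 + 1 / (v : ℝ)) * x ^ 2 / 2 + y / v * x) := by
  have hv' : (v : ℝ) ≠ 0 := by exact_mod_cast hv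
  have : Real.exp (-(x - 0) ^ 2 / (2 * ((1 : ℝ≥0) : ℝ))) * Real.exp (-(y - x) ^ 2 / (2 * v))
      = Real.exp (-y ^ 2 / (2 * v)) * Real.exp (-(1 + 1 / (v : ℝ)) * x ^ 2 / 2 + y / v * x) := by
    rw [← Real.exp_add, ← Real.exp_add]; congr 1; simp; field_simp; ring
  rw [mul_assoc _ (Real.exp _) (Real.exp _), ← this, gaussianPDFReal, gaussianPDFReal]
  simp; ring

/-- For fixed `y` the joint density in `x` is a constant times a quadratic exponential with `p = 1 +
1 / v ≥ 1` and `r = y / v`, so the truncated-normal bound applies inside the integral over `y`.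
Testing on every event `Y ∈ B` is what the comparison with the conditional expectation needs. -/
theorem setLIntegral_fst_le {v : ℝ≥0} (hv : v ≠ 0) {B : Set ℝ} (hB : MeasurableSet B) :
    ∫⁻ ω in {ω : ℝ × ℝ | ω.1 + ω.2 ∈ B}, ENNReal.ofReal ω.1
        ∂(halfNormal.prod (gaussianReal 0 v))
      ≤ ∫⁻ ω in {ω : ℝ × ℝ | ω.1 + ω.2 ∈ B}, ENNReal.ofReal (posteriorBound v (ω.1 + ω.2))
        ∂(halfNormal.prod (gaussianReal 0 v)) := by
  have hv0 : (0 : ℝ) < v := by positivity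
  have hS : MeasurableSet {ω : ℝ × ℝ | ω.1 + ω.2 ∈ B} :=
    hB.preimage (measurable_fst.add measurable_snd)
  have hmB : MeasurableSet {z : ℝ × ℝ | z.2 ∈ B} := hB.preimage measurable_snd
  rw [← lintegral_indicator hS, ← lintegral_indicator hS]
  have e1 := lintegral_halfNormal_prod hv
    (h := {z : ℝ × ℝ | z.2 ∈ B}.indicator fun z => ENNReal.ofReal z.1)
    (Measurable.indicator (by fun_prop) hmB)
  have e2 := lintegral_halfNormal_prod hv
    (h := {z : ℝ × ℝ | z.2 ∈ B}.indicator fun z => ENNReal.ofReal (posteriorBound v z.2))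
    (Measurable.indicator (by fun_prop) hmB)
  refine (e1.trans_le ?_).trans e2.ge
  refine lintegral_mono fun y => ?_
  by_cases hy : y ∈ B
  swap
  · simp [Set.indicator, hy]
  simp only [Set.indicator, Set.mem_ofPred_eq, hy, if_true]
  set K := 2 * (√(2 * Real.pi))⁻¹ * (√(2 * Real.pi * v))⁻¹ * Real.exp (-y ^ 2 / (2 * v)) with hK
  have hK0 : 0 ≤ K := by positivity
  have hden : ∀ x (a : ℝ≥0∞), ENNReal.ofReal (2 * gaussianPDFReal 0 1 x) * (gaussianPDF x v y * a)
      = ENNReal.ofReal K * (a *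
        ENNReal.ofReal (Real.exp (-(1 + 1 / (v : ℝ)) * x ^ 2 / 2 + y / v * x))) := by
    intro x a
    rw [← mul_assoc, gaussianPDF, ← ENNReal.ofReal_mul (mul_nonneg two_pos.le
      (gaussianPDFReal_nonneg 0 1 x)), two_mul_gaussianPDFReal_mul hv, ← hK,
      ENNReal.ofReal_mul hK0]
    ring
  simp_rw [hden]
  rw [lintegral_const_mul _ (by fun_prop), lintegral_const_mul _ (by fun_prop),
    lintegral_const_mul _ (by fun_prop)]
  have hp : max (y / v) 0 / (1 + 1 / (v : ℝ)) + 1 = posteriorBound v y := by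
    rw [posteriorBound, show max (y / v) 0 = max y 0 / (v : ℝ) by
      rw [← max_div_div_right hv0.le, zero_div]]
    field_simp
  rw [← hp]
  gcongr
  exact lintegral_Ioi_mul_exp_quadratic_le (by simp) (y / v)

/-! ### Integrability and posterior means in the box model. -/

section Boxes

variable {n : ℕ} (σ : Fin n → ℝ≥0)

instance isProbabilityMeasure_boxLaw : IsProbabilityMeasure (boxLaw halfNormal σ) := by
  unfold boxLaw; infer_instance

theorem measurePreserving_eval_boxLaw (i : Fin n) :
    MeasurePreserving (Function.eval i) (boxLaw halfNormal σ)
      (halfNormal.prod (gaussianReal 0 (σ i ^ 2))) :=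
  measurePreserving_eval (fun i => halfNormal.prod (gaussianReal 0 (σ i ^ 2))) i

theorem measurePreserving_reward (i : Fin n) :
    MeasurePreserving (reward i) (boxLaw halfNormal σ) halfNormal :=
  measurePreserving_fst.comp (measurePreserving_eval_boxLaw σ i)

theorem measurePreserving_noise (i : Fin n) :
    MeasurePreserving (fun ω => (ω i).2) (boxLaw halfNormal σ) (gaussianReal 0 (σ i ^ 2)) :=
  measurePreserving_snd.comp (measurePreserving_eval_boxLaw σ i)

@[fun_prop]
theorem measurable_obs (i : Fin n) : Measurable (obs i) := by
  unfold obs; fun_prop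

@[fun_prop]
theorem measurable_reward (i : Fin n) : Measurable (reward i) := by
  unfold reward; fun_prop

theorem comap_obs_le (i : Fin n) :
    MeasurableSpace.comap (obs i) inferInstance ≤ (inferInstance : MeasurableSpace (Fin n → ℝ × ℝ)) :=
  (measurable_obs i).comap_le

theorem integrable_reward (i : Fin n) : Integrable (reward i) (boxLaw halfNormal σ) :=
  (measurePreserving_reward σ i).integrable_comp_of_integrable integrable_id_halfNormal

theorem integrable_noise (i : Fin n) :
    Integrable (fun ω => (ω i).2) (boxLaw halfNormal σ) :=
  (measurePreserving_noise σ i).integrable_comp_of_integrable (g := fun z => z)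
    ((memLp_id_gaussianReal (μ := 0) 1).integrable (by simp))

theorem integrable_obs (i : Fin n) : Integrable (obs i) (boxLaw halfNormal σ) :=
  (integrable_reward σ i).add (integrable_noise σ i)

theorem integrable_posteriorBound_obs (v : ℝ≥0) (i : Fin n) :
    Integrable (fun ω => posteriorBound v (obs i ω)) (boxLaw halfNormal σ) :=
  ((integrable_obs σ i).pos_part.div_const _).add (integrable_const 1)

theorem reward_ae_nonneg (i : Fin n) : ∀ᵐ ω ∂boxLaw halfNormal σ, 0 ≤ reward i ω :=
  (measurePreserving_reward σ i).quasiMeasurePreserving.ae halfNormal_ae_nonneg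

theorem setIntegral_reward_le {i : Fin n} (hσ : σ i ≠ 0) {B : Set ℝ} (hB : MeasurableSet B) :
    ∫ ω in obs i ⁻¹' B, reward i ω ∂boxLaw halfNormal σ
      ≤ ∫ ω in obs i ⁻¹' B, posteriorBound (σ i ^ 2) (obs i ω) ∂boxLaw halfNormal σ := by
  have hS : MeasurableSet {ω : ℝ × ℝ | ω.1 + ω.2 ∈ B} :=
    hB.preimage (measurable_fst.add measurable_snd)
  have hmp := measurePreserving_eval_boxLaw σ i
  have hI := ((integrable_posteriorBound_obs σ (σ i ^ 2) i).integrableOn (s := obs i ⁻¹' B))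
  have h0 : 0 ≤ᵐ[(boxLaw halfNormal σ).restrict (obs i ⁻¹' B)]
      fun ω => posteriorBound (σ i ^ 2) (obs i ω) :=
    ae_of_all _ fun ω => posteriorBound_nonneg _ _
  rw [← ENNReal.ofReal_le_ofReal_iff (integral_nonneg_of_ae h0),
    ofReal_integral_eq_lintegral_ofReal (integrable_reward σ i).integrableOn
      (ae_restrict_of_ae (reward_ae_nonneg σ i)), ofReal_integral_eq_lintegral_ofReal hI h0]
  have key := setLIntegral_fst_le (pow_ne_zero 2 hσ) hB
  rw [← hmp.setLIntegral_comp_preimage hS (by fun_prop),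
    ← hmp.setLIntegral_comp_preimage hS (by fun_prop)] at key
  exact key

theorem integrable_posteriorMean (i : Fin n) :
    Integrable (posteriorMean halfNormal σ i) (boxLaw halfNormal σ) := integrable_condExp

theorem posteriorMean_ae_le_posteriorBound {i : Fin n} (hσ : σ i ≠ 0) :
    ∀ᵐ ω ∂boxLaw halfNormal σ,
      posteriorMean halfNormal σ i ω ≤ posteriorBound (σ i ^ 2) (obs i ω) := by
  have hm := comap_obs_le i
  have hmeas : StronglyMeasurable[MeasurableSpace.comap (obs i) inferInstance]
      fun ω => posteriorBound (σ i ^ 2) (obs i ω) :=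
    ((measurable_posteriorBound _).comp (comap_measurable (obs i))).stronglyMeasurable
  have hmean : StronglyMeasurable[MeasurableSpace.comap (obs i) inferInstance]
      (posteriorMean halfNormal σ i) := stronglyMeasurable_condExp
  -- Both sides are measurable in the observation alone, so after trimming to its σ-algebra it is
  -- enough to compare integrals over the events `obs i ⁻¹' B`.
  refine ae_le_of_ae_le_trim (hm := hm) (ae_le_of_forall_setIntegral_le
    ((integrable_posteriorMean σ i).trim hm hmean)
    ((integrable_posteriorBound_obs σ _ i).trim hm hmeas) fun s hs _ => ?_)
  rw [← setIntegral_trim hm hmean hs, ← setIntegral_trim hm hmeas hs, posteriorMean,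
    setIntegral_condExp hm (integrable_reward σ i) hs]
  obtain ⟨B, hB, rfl⟩ := hs
  exact setIntegral_reward_le σ hσ hB

/-- `E[(X_i - t)⁺ | Y_i]`. -/
noncomputable def posteriorExcess (t : ℝ) (i : Fin n) : (Fin n → ℝ × ℝ) → ℝ :=
  (boxLaw halfNormal σ)[fun ω => max (reward i ω - t) 0 |
    MeasurableSpace.comap (obs i) inferInstance]

theorem integrable_excess_reward (t : ℝ) (i : Fin n) :
    Integrable (fun ω => max (reward i ω - t) 0) (boxLaw halfNormal σ) :=
  ((integrable_reward σ i).sub (integrable_const t)).pos_part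

theorem integral_excess_reward_le {t : ℝ} (ht : 1 ≤ t) (i : Fin n) :
    ∫ ω, max (reward i ω - t) 0 ∂boxLaw halfNormal σ ≤ Real.exp (-t ^ 2 / 2) := by
  have h := integral_excess_halfNormal_le ht
  rw [← (measurePreserving_reward σ i).map_eq, integral_map (by fun_prop) (by fun_prop)] at h
  exact h

theorem integral_posteriorExcess_le {t : ℝ} (ht : 1 ≤ t) (i : Fin n) :
    ∫ ω, posteriorExcess σ t i ω ∂boxLaw halfNormal σ ≤ Real.exp (-t ^ 2 / 2) := by
  rw [posteriorExcess, integral_condExp (comap_obs_le i)]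
  exact integral_excess_reward_le σ ht i

theorem posteriorExcess_ae_nonneg (t : ℝ) (i : Fin n) :
    ∀ᵐ ω ∂boxLaw halfNormal σ, 0 ≤ posteriorExcess σ t i ω :=
  condExp_nonneg (ae_of_all _ fun _ => le_max_right _ _)

/-- Conditional form of `X ≤ t + (X - t)⁺`. As the excesses are nonnegative, a maximum of posterior
means is at most `t` plus their sum. No lower bound on the noise is needed, so noiseless boxes are
covered. -/
theorem posteriorMean_ae_le_add_posteriorExcess (t : ℝ) (i : Fin n) :
    ∀ᵐ ω ∂boxLaw halfNormal σ,
      posteriorMean halfNormal σ i ω ≤ t + posteriorExcess σ t i ω := by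
  have h1 := condExp_mono (m := MeasurableSpace.comap (obs i) inferInstance)
    (integrable_reward σ i) ((integrable_const t).add (integrable_excess_reward σ t i))
    (ae_of_all _ fun ω => by
      simp only [Pi.add_apply]; linarith [le_max_left (reward i ω - t) 0])
  have h2 := condExp_add (integrable_const t) (integrable_excess_reward σ t i)
    (MeasurableSpace.comap (obs i) inferInstance)
  rw [condExp_const (comap_obs_le i)] at h2
  filter_upwards [h1, h2] with ω h1 h2
  exact h1.trans h2.le

/-! ### Upper bound for the clairvoyant reward. -/

theorem measurePreserving_noise_div {i : Fin n} (hσ : σ i ≠ 0) :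
    MeasurePreserving (fun ω => (ω i).2 / (σ i : ℝ)) (boxLaw halfNormal σ) (gaussianReal 0 1) := by
  have h := measurePreserving_noise σ i
  refine ⟨by fun_prop, ?_⟩
  have : (fun ω : Fin n → ℝ × ℝ => (ω i).2 / (σ i : ℝ))
      = (fun x => x / (σ i : ℝ)) ∘ fun ω => (ω i).2 := rfl
  rw [this, ← Measure.map_map (by fun_prop) (by fun_prop), h.map_eq, gaussianReal_map_div_const]
  congr 1
  · simp
  · ext; simp [hσ]

theorem integrable_excess_noise (t : ℝ) {i : Fin n} (hσ : σ i ≠ 0) :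
    Integrable (fun ω => max (|(ω i).2 / (σ i : ℝ)| - t) 0) (boxLaw halfNormal σ) :=
  (measurePreserving_noise_div σ hσ).integrable_comp_of_integrable
    (integrable_excess_gaussianReal t)

theorem integral_excess_noise_le {t : ℝ} (ht : 1 ≤ t) {i : Fin n} (hσ : σ i ≠ 0) :
    ∫ ω, max (|(ω i).2 / σ i| - t) 0 ∂boxLaw halfNormal σ ≤ Real.exp (-t ^ 2 / 2) := by
  have h := integral_excess_gaussianReal_le ht
  have hmp := measurePreserving_noise_div σ hσ
  rw [← hmp.map_eq, integral_map hmp.aemeasurable (by fun_prop)] at h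
  exact h

/-- With `z = e / v`, both `x / (v ^ 2 + 1)` and `v |z| / (v ^ 2 + 1)` gain a factor `1 / v ≤ 1 /
s`. Here `v` is the standard deviation, and `x` and `|z|` are each split at the level `t`. -/
theorem posteriorBound_add_le {v : ℝ≥0} {s x e : ℝ} (hs : 0 < s) (hv : s ≤ v) (hx : 0 ≤ x) (t : ℝ) :
    posteriorBound (v ^ 2) (x + e)
      ≤ 1 + s⁻¹ * (2 * t + (max (x - t) 0 + max (|e / v| - t) 0)) := by
  have hv0 : (0 : ℝ) < v := hs.trans_le hv
  have h1 : max (x + e) 0 ≤ x + |e| := max_le (by linarith [le_abs_self e]) (by positivity)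
  have h2 : |e| = v * |e / v| := by
    rw [abs_div, abs_of_pos hv0]; field_simp
  have h3 : x + v * |e / v| ≤ (s⁻¹ * (x + |e / v|)) * ((v : ℝ) ^ 2 + 1) := by
    rw [inv_mul_eq_div, div_mul_eq_mul_div, le_div_iff₀ hs]
    have hz := abs_nonneg (e / v)
    nlinarith [mul_le_mul_of_nonneg_left hv hx, mul_le_mul_of_nonneg_left hv (mul_nonneg hv0.le hz),
      mul_nonneg hx (sq_nonneg ((v : ℝ) - 1))]
  have h4 : max (x + e) 0 / ((v : ℝ) ^ 2 + 1) ≤ s⁻¹ * (x + |e / v|) := by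
    rw [div_le_iff₀ (by positivity)]
    linarith
  have h5 : s⁻¹ * (x + |e / v|)
      ≤ s⁻¹ * (2 * t + (max (x - t) 0 + max (|e / v| - t) 0)) := by
    refine mul_le_mul_of_nonneg_left ?_ (inv_pos.2 hs).le
    linarith [le_max_left (x - t) 0, le_max_left (|e / v| - t) 0]
  rw [posteriorBound, NNReal.coe_pow]
  linarith

/-- If all boxes outside `S` have noise at least `s`, then the boxes of `S` contribute at most the
expected maximum of `#S` rewards, and the others have posterior means of order `1 / s`. -/
theorem optReward_le (S : Finset (Fin n)) {s t₁ t₂ : ℝ} (hs : 0 < s) (hS : ∀ i ∉ S, s ≤ σ i)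
    (ht₁ : 1 ≤ t₁) (ht₂ : 1 ≤ t₂) :
    optReward halfNormal σ ≤ t₁ + S.card * Real.exp (-t₁ ^ 2 / 2)
      + (1 + s⁻¹ * (2 * t₂ + 2 * (n * Real.exp (-t₂ ^ 2 / 2)))) := by
  have hσ : ∀ i ∉ S, σ i ≠ 0 := fun i hi h => by
    have := hS i hi; rw [h] at this; simp at this; linarith
  set A : (Fin n → ℝ × ℝ) → ℝ := fun ω => ∑ i ∈ S, posteriorExcess σ t₁ i ω with hA
  set B : (Fin n → ℝ × ℝ) → ℝ := fun ω => ∑ i ∈ Sᶜ,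
    (max (reward i ω - t₂) 0 + max (|(ω i).2 / σ i| - t₂) 0) with hB
  have hBi : ∀ i ∈ Sᶜ, Integrable (fun ω => max (reward i ω - t₂) 0 + max (|(ω i).2 / σ i| - t₂) 0)
      (boxLaw halfNormal σ) := fun i hi =>
    (integrable_excess_reward σ t₂ i).add
      (integrable_excess_noise σ t₂ (hσ i (Finset.mem_compl.1 hi)))
  have hAi : ∀ i ∈ S, Integrable (posteriorExcess σ t₁ i) (boxLaw halfNormal σ) :=
    fun i _ => integrable_condExp
  have hAint : Integrable A (boxLaw halfNormal σ) := integrable_finsetSum _ hAi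
  have hBint : Integrable B (boxLaw halfNormal σ) := integrable_finsetSum _ hBi
  have hA1 : ∫ ω, A ω ∂boxLaw halfNormal σ ≤ S.card * Real.exp (-t₁ ^ 2 / 2) := by
    rw [hA, integral_finsetSum _ hAi, ← nsmul_eq_mul]
    exact Finset.sum_le_card_nsmul _ _ _ fun i _ => integral_posteriorExcess_le σ ht₁ i
  have hB1 : ∫ ω, B ω ∂boxLaw halfNormal σ ≤ 2 * (n * Real.exp (-t₂ ^ 2 / 2)) := by
    rw [hB, integral_finsetSum _ hBi]
    calc _ ≤ Sᶜ.card • (2 * Real.exp (-t₂ ^ 2 / 2)) := by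
          refine Finset.sum_le_card_nsmul _ _ _ fun i hi => ?_
          have hi := hσ i (Finset.mem_compl.1 hi)
          rw [integral_add (integrable_excess_reward σ t₂ i) (integrable_excess_noise σ t₂ hi)]
          linarith [integral_excess_reward_le σ ht₂ i, integral_excess_noise_le σ ht₂ hi]
      _ ≤ n * (2 * Real.exp (-t₂ ^ 2 / 2)) := by
          rw [nsmul_eq_mul]
          gcongr
          simpa using Finset.card_le_univ Sᶜ
      _ = _ := by ring
  have hle : ∀ᵐ ω ∂boxLaw halfNormal σ,
      ⨆ i, posteriorMean halfNormal σ i ω ≤ (t₁ + A ω) + (1 + s⁻¹ * (2 * t₂ + B ω)) := by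
    have h1 := ae_all_iff.2 fun i => posteriorExcess_ae_nonneg σ t₁ i
    have h2 := ae_all_iff.2 fun i => posteriorMean_ae_le_add_posteriorExcess σ t₁ i
    have h3 : ∀ᵐ ω ∂boxLaw halfNormal σ, ∀ i : Fin n, i ∉ S →
        posteriorMean halfNormal σ i ω ≤ posteriorBound (σ i ^ 2) (obs i ω) :=
      ae_all_iff.2 fun i => by
        by_cases hi : i ∈ S
        · exact ae_of_all _ fun ω h => (h hi).elim
        · filter_upwards [posteriorMean_ae_le_posteriorBound σ (hσ i hi)] with ω h _ using h
    have h4 := ae_all_iff.2 fun i => reward_ae_nonneg σ i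
    filter_upwards [h1, h2, h3, h4] with ω h1 h2 h3 h4
    have hA0 : 0 ≤ A ω := Finset.sum_nonneg fun i _ => h1 i
    have hB0 : ∀ i ∈ Sᶜ, 0 ≤ max (reward i ω - t₂) 0 + max (|(ω i).2 / σ i| - t₂) 0 :=
      fun i _ => add_nonneg (le_max_right _ _) (le_max_right _ _)
    have hB0' : 0 ≤ B ω := Finset.sum_nonneg hB0
    -- Nonnegativity of the bound covers `n = 0`, where the real supremum is `0`.
    refine Real.iSup_le (fun i => ?_) (by positivity)
    by_cases hi : i ∈ S
    · have : posteriorExcess σ t₁ i ω ≤ A ω :=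
        Finset.single_le_sum (f := fun i => posteriorExcess σ t₁ i ω) (fun i _ => h1 i) hi
      have h0 : 0 ≤ 1 + s⁻¹ * (2 * t₂ + B ω) := by positivity
      linarith [h2 i]
    · have h5 : max (reward i ω - t₂) 0 + max (|(ω i).2 / σ i| - t₂) 0 ≤ B ω :=
        Finset.single_le_sum hB0 (Finset.mem_compl.2 hi)
      have h6 : s⁻¹ * (2 * t₂ + (max (reward i ω - t₂) 0 + max (|(ω i).2 / σ i| - t₂) 0))
          ≤ s⁻¹ * (2 * t₂ + B ω) := by gcongr
      have h7 : posteriorBound (σ i ^ 2) (obs i ω) ≤ _ :=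
        posteriorBound_add_le (e := (ω i).2) hs (hS i hi) (h4 i) t₂
      linarith [h3 i hi]
  have hint1 : Integrable (fun ω => t₁ + A ω) (boxLaw halfNormal σ) :=
    (integrable_const _).add hAint
  have hint2 : Integrable (fun ω => 2 * t₂ + B ω) (boxLaw halfNormal σ) :=
    (integrable_const _).add hBint
  have hint3 : Integrable (fun ω => 1 + s⁻¹ * (2 * t₂ + B ω)) (boxLaw halfNormal σ) :=
    (integrable_const _).add (hint2.const_mul _)
  calc optReward halfNormal σ
      ≤ ∫ ω, (t₁ + A ω) + (1 + s⁻¹ * (2 * t₂ + B ω)) ∂boxLaw halfNormal σ :=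
        integral_mono_ae (integrable_iSup_of_forall (integrable_posteriorMean σ))
          (hint1.add hint3) hle
    _ = (t₁ + ∫ ω, A ω ∂boxLaw halfNormal σ)
        + (1 + s⁻¹ * (2 * t₂ + ∫ ω, B ω ∂boxLaw halfNormal σ)) := by
        rw [integral_add hint1 hint3, integral_add (integrable_const _) hAint,
          integral_add (integrable_const _) (hint2.const_mul _), integral_const_mul,
          integral_add (integrable_const _) hBint]
        simp
    _ ≤ _ := by gcongr

end Boxes

/-! ### Optimality of the clairvoyant policy. -/

theorem integral_mul_reward_of_obs {n : ℕ} (σ : Fin n → ℝ≥0) (i : Fin n) {u : ℝ → ℝ}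
    (hu : Measurable u) (hu1 : ∀ y, |u y| ≤ 1) :
    ∫ ω, u (obs i ω) * reward i ω ∂boxLaw halfNormal σ
      = ∫ ω, u (obs i ω) * posteriorMean halfNormal σ i ω ∂boxLaw halfNormal σ := by
  have hm := comap_obs_le i
  have hsm : StronglyMeasurable[MeasurableSpace.comap (obs i) inferInstance]
      fun ω => u (obs i ω) := (hu.comp (comap_measurable (obs i))).stronglyMeasurable
  have hint : Integrable ((fun ω => u (obs i ω)) * reward i) (boxLaw halfNormal σ) :=
    (integrable_reward σ i).bdd_mul (c := 1) (hsm.mono hm).aestronglyMeasurable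
      (ae_of_all _ fun ω => hu1 _)
  have h := condExp_mul_of_stronglyMeasurable_left hsm hint (integrable_reward σ i)
  calc _ = ∫ ω, ((boxLaw halfNormal σ)[(fun ω => u (obs i ω)) * reward i |
          MeasurableSpace.comap (obs i) inferInstance]) ω ∂boxLaw halfNormal σ :=
        (integral_condExp hm).symm
    _ = _ := integral_congr_ae h

/-- The other observations carry no information about the reward of box `i`. -/
theorem integral_mul_reward {n : ℕ} (σ : Fin n → ℝ≥0) (i : Fin n) {p : (Fin n → ℝ) → ℝ}
    (hp : Measurable p) (hp1 : ∀ y, |p y| ≤ 1) :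
    ∫ ω, p (fun j => obs j ω) * reward i ω ∂boxLaw halfNormal σ
      = ∫ ω, p (fun j => obs j ω) * posteriorMean halfNormal σ i ω ∂boxLaw halfNormal σ := by
  obtain _ | n := n
  · exact i.elim0
  have hmean : StronglyMeasurable[MeasurableSpace.comap (obs i) inferInstance]
      (posteriorMean halfNormal σ i) := stronglyMeasurable_condExp
  -- Writing the posterior mean as `ψ (obs i ω)` makes it depend on box `i` only, so it survives
  -- freezing the other boxes.
  obtain ⟨ψ, hψ, hψeq⟩ := hmean.exists_eq_measurable_comp
  have hψm := hψ.measurable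
  have hbox := measurePreserving_eval_boxLaw σ i
  have hmp := (measurePreserving_piFinSuccAbove
    (fun i => halfNormal.prod (gaussianReal 0 (σ i ^ 2))) i).symm
  set ν := Measure.pi fun j => halfNormal.prod (gaussianReal 0 (σ (i.succAbove j) ^ 2)) with hν
  set e := (MeasurableEquiv.piFinSuccAbove (fun _ : Fin (n + 1) => ℝ × ℝ) i).symm
  have he : ∀ z j, e z j = i.insertNth (α := fun _ => ℝ × ℝ) z.1 z.2 j := fun _ _ => rfl
  have hobs : ∀ z j, obs j (e z)
      = i.insertNth (α := fun _ => ℝ) (z.1.1 + z.1.2) (fun j => (z.2 j).1 + (z.2 j).2) j := by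
    intro z j
    refine Fin.succAboveCases i ?_ (fun j => ?_) j <;> simp [obs, he]
  have hrew : ∀ z, reward i (e z) = z.1.1 := by
    intro z; simp [reward, he]
  have hpm : Measurable fun ω : Fin (n + 1) → ℝ × ℝ => p fun j => obs j ω :=
    hp.comp (measurable_pi_lambda _ fun j => measurable_obs j)
  have hbd : ∀ {g : (Fin (n + 1) → ℝ × ℝ) → ℝ}, Integrable g (boxLaw halfNormal σ) →
      Integrable (fun ω => p (fun j => obs j ω) * g ω) (boxLaw halfNormal σ) := fun hg =>
    hg.bdd_mul (c := 1) hpm.aestronglyMeasurable (ae_of_all _ fun ω => hp1 _)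
  have h1 := hbd (integrable_reward σ i)
  have h2 := hbd (integrable_posteriorMean σ i)
  rw [hψeq] at h2 ⊢
  rw [boxLaw] at h1 h2 ⊢
  rw [← hmp.integral_comp', ← hmp.integral_comp', integral_prod_symm, integral_prod_symm]
  · refine integral_congr_ae (ae_of_all _ fun r => ?_)
    -- With the other boxes frozen at `r`, the weight is a bounded function of the `i`-th
    -- observation alone, and the one-box identity applies.
    set u : ℝ → ℝ := fun y =>
      p fun j => i.insertNth (α := fun _ => ℝ) y (fun j => (r j).1 + (r j).2) j with hu_def
    have hu : Measurable u := hp.comp (measurable_pi_lambda _ fun j => by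
      refine Fin.succAboveCases i ?_ (fun j => ?_) j
      · simpa using measurable_id'
      · simp)
    have key := integral_mul_reward_of_obs σ i hu fun y => hp1 _
    rw [hψeq] at key
    have e1 := integral_map (μ := boxLaw halfNormal σ) hbox.aemeasurable
      (f := fun a : ℝ × ℝ => u (a.1 + a.2) * a.1) (by fun_prop)
    have e2 := integral_map (μ := boxLaw halfNormal σ) hbox.aemeasurable
      (f := fun a : ℝ × ℝ => u (a.1 + a.2) * ψ (a.1 + a.2)) (by fun_prop)
    rw [hbox.map_eq] at e1 e2
    simp only [Function.comp, hobs, hrew]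
    simp only [Fin.insertNth_apply_same]
    exact e1.trans (key.trans e2.symm)
  · exact hmp.integrable_comp_of_integrable h2
  · exact hmp.integrable_comp_of_integrable h1

/-- Once rewards are replaced by posterior means, a policy earns a convex combination of them, which
is at most their maximum. -/
theorem policyReward_le_optReward {n : ℕ} (σ : Fin n → ℝ≥0) (A : Policy n) :
    policyReward halfNormal σ A ≤ optReward halfNormal σ := by
  have hle1 : ∀ i y, |A.prob σ y i| ≤ 1 := fun i y => by
    rw [abs_of_nonneg (A.prob_nonneg σ y i), ← A.prob_sum σ y]
    exact Finset.single_le_sum (f := A.prob σ y) (fun j _ => A.prob_nonneg σ y j)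
      (Finset.mem_univ i)
  have hpm : ∀ i, Measurable fun ω : Fin n → ℝ × ℝ => A.prob σ (fun j => obs j ω) i := fun i =>
    (A.measurable_prob σ i).comp (measurable_pi_lambda _ fun j => measurable_obs j)
  have hbd : ∀ {g : Fin n → (Fin n → ℝ × ℝ) → ℝ}, (∀ i, Integrable (g i) (boxLaw halfNormal σ)) →
      ∀ i ∈ Finset.univ,
      Integrable (fun ω => A.prob σ (fun j => obs j ω) i * g i ω) (boxLaw halfNormal σ) :=
    fun hg i _ => (hg i).bdd_mul (c := 1) (hpm i).aestronglyMeasurable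
      (ae_of_all _ fun ω => hle1 i _)
  have hX := hbd (integrable_reward σ)
  have hM := hbd (integrable_posteriorMean σ)
  calc policyReward halfNormal σ A
      = ∫ ω, ∑ i, A.prob σ (fun j => obs j ω) i * posteriorMean halfNormal σ i ω
          ∂boxLaw halfNormal σ := by
        rw [policyReward, integral_finsetSum _ hX, integral_finsetSum _ hM]
        exact Finset.sum_congr rfl fun i _ =>
          integral_mul_reward σ i (A.measurable_prob σ i) (hle1 i)
    _ ≤ optReward halfNormal σ := by
        refine integral_mono (integrable_finsetSum _ hM)
          (integrable_iSup_of_forall (integrable_posteriorMean σ)) fun ω => ?_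
        calc _ ≤ ∑ i, A.prob σ (fun j => obs j ω) i * ⨆ i, posteriorMean halfNormal σ i ω :=
              Finset.sum_le_sum fun i _ => mul_le_mul_of_nonneg_left
                (le_ciSup (f := fun i => posteriorMean halfNormal σ i ω)
                  (Set.finite_range _).bddAbove i) (A.prob_nonneg _ _ _)
          _ = _ := by rw [← Finset.sum_mul, A.prob_sum, one_mul]

/-! ### Asymptotics under medium noise. -/

/-- `E[D_{k:k}]` for `k = ⌊n ^ c⌋` is at least of order `√(c * log n)`. -/
theorem sqrt_le_expMax_floor_rpow {n : ℕ} {c : ℝ} (hn : 0 < n) (hc : 5 ≤ c * Real.log n) :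
    √(c * Real.log n / 2) / 4 ≤ expMax halfNormal ⌊(n : ℝ) ^ c⌋₊ := by
  have hn0 : (0 : ℝ) < n := by exact_mod_cast hn
  have hpow : (n : ℝ) ^ c = Real.exp (c * Real.log n) := by
    rw [Real.rpow_def_of_pos hn0, mul_comm]
  have h101 : (101 : ℝ) ≤ (n : ℝ) ^ c := by
    rw [hpow]
    refine le_trans ?_ (Real.exp_le_exp.2 hc)
    have h5 : Real.exp 5 = Real.exp 1 ^ 5 := by rw [← Real.exp_nat_mul]; norm_num
    have : (2.7 : ℝ) ^ 5 ≤ Real.exp 1 ^ 5 := by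
      gcongr; linarith [Real.exp_one_gt_d9]
    rw [h5]
    norm_num at this ⊢; linarith
  have hk : 100 ≤ ⌊(n : ℝ) ^ c⌋₊ := Nat.le_floor (by push_cast; linarith)
  refine le_trans ?_ (sqrt_log_le_expMax hk)
  -- Rounding down costs at most a factor `2`, and `n ^ c / 2 ≥ √(n ^ c)`; hence the `1/2` under the
  -- root.
  have hfl : (n : ℝ) ^ c / 2 ≤ ⌊(n : ℝ) ^ c⌋₊ := by
    linarith [Nat.sub_one_lt_floor ((n : ℝ) ^ c)]
  have hlog : c * Real.log n / 2 ≤ Real.log ⌊(n : ℝ) ^ c⌋₊ := by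
    rw [Real.le_log_iff_exp_le (by linarith)]
    refine le_trans ?_ hfl
    have h2 : 2 ≤ Real.exp (c * Real.log n / 2) := by
      linarith [Real.add_one_le_exp (c * Real.log n / 2)]
    have h3 : (n : ℝ) ^ c = Real.exp (c * Real.log n / 2) * Real.exp (c * Real.log n / 2) := by
      rw [hpow, ← Real.exp_add]; congr 1; ring
    rw [h3]; nlinarith
  gcongr

theorem optReward_le_of_mem_mediumNoise {n : ℕ} (hn : 100 ≤ n) {c : ℝ} (hc0 : 0 < c)
    (hc : 5 ≤ c * Real.log n) (hc1 : c ≤ 1) {σ : Fin n → ℝ≥0} (hσ : σ ∈ mediumNoise halfNormal n c) :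
    optReward halfNormal σ ≤ 4000 * (√c * expMax halfNormal n) := by
  obtain ⟨hmono, i, hi, hnoise⟩ := hσ
  have hn0 : (0 : ℝ) < n := by exact_mod_cast (by lia : 0 < n)
  have hE := sqrt_le_expMax_floor_rpow (by lia) hc
  have hEn := sqrt_log_le_expMax hn
  set L := Real.log n with hL
  have hL5 : 5 ≤ L := by
    by_contra! h
    rcases le_total L 0 with h0 | h0 <;> nlinarith
  set E := expMax halfNormal ⌊(n : ℝ) ^ c⌋₊
  set s := E / (18 * c * √(2 * L)) with hs_def
  have hE0 : 0 < E := lt_of_lt_of_le (by positivity) hE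
  have hs : 0 < s := by positivity
  -- Only boxes strictly before `i` are taken, so `S` has `⌈n ^ c⌉ - 1 < n ^ c` elements. Box `i`
  -- itself already has noise above `s`.
  set S : Finset (Fin n) := Finset.univ.filter fun j => j < i with hS_def
  have hcard : (S.card : ℝ) ≤ Real.exp (c * L) := by
    have h1 : S.card = i := by simp [hS_def, Finset.filter_gt_eq_Iio]
    have h2 : ((i : ℕ) : ℝ) + 1 < (n : ℝ) ^ c + 1 := by
      have := Nat.ceil_lt_add_one (Real.rpow_nonneg hn0.le c)
      rw [← hi] at this; exact_mod_cast this
    have h3 : (n : ℝ) ^ c = Real.exp (c * L) := by rw [Real.rpow_def_of_pos hn0, mul_comm]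
    rw [h1, ← h3]; linarith
  -- At the levels `√(2 c L)` and `√(2 L)` the factors `exp (-t ^ 2 / 2)` are `n ^ (-c)` and `n ^
  -- (-1)`, which cancel the numbers of boxes in the two union bounds.
  have ht₁ : 1 ≤ √(2 * (c * L)) := Real.le_sqrt_of_sq_le (by linarith)
  have ht₂ : 1 ≤ √(2 * L) := Real.le_sqrt_of_sq_le (by linarith)
  have hopt := optReward_le σ S hs (fun j hj => ?_) ht₁ ht₂
  swap
  · have hij : i ≤ j := by simpa [hS_def] using hj
    exact hnoise.le.trans (NNReal.coe_le_coe.2 (hmono hij))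
  have e1 : S.card * Real.exp (-√(2 * (c * L)) ^ 2 / 2) ≤ 1 := by
    rw [Real.sq_sqrt (by linarith)]
    calc _ ≤ Real.exp (c * L) * Real.exp (-(2 * (c * L)) / 2) := by gcongr
      _ = 1 := by rw [← Real.exp_add, ← Real.exp_zero]; congr 1; ring
  have e2 : n * Real.exp (-√(2 * L) ^ 2 / 2) = 1 := by
    rw [Real.sq_sqrt (by linarith), show -(2 * L) / 2 = -L by ring, Real.exp_neg, hL,
      Real.exp_log hn0]
    exact mul_inv_cancel₀ hn0.ne'
  rw [e2] at hopt
  set a := √c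
  set b := √L
  have ha0 : 0 < a := Real.sqrt_pos.2 hc0
  have hb0 : 0 < b := Real.sqrt_pos.2 (by linarith)
  have ha : a ^ 2 = c := Real.sq_sqrt hc0.le
  have hb : b ^ 2 = L := Real.sq_sqrt (by linarith)
  have hab : 2 ≤ a * b := by
    refine (sq_le_sq₀ two_pos.le (by positivity)).1 ?_
    rw [mul_pow, ha, hb]; linarith
  have hsq2L : √(2 * L) ≤ 3 / 2 * b :=
    Real.sqrt_le_iff.2 ⟨by positivity, by rw [mul_pow, hb]; linarith⟩
  have hsq2cL : √(2 * (c * L)) ≤ 3 / 2 * (a * b) :=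
    Real.sqrt_le_iff.2 ⟨by positivity, by rw [mul_pow, mul_pow, ha, hb]; linarith⟩
  have hElow : a * b / 6 ≤ E := by
    refine le_trans ?_ hE
    have : 2 / 3 * (a * b) ≤ √(c * L / 2) :=
      Real.le_sqrt_of_sq_le (by rw [mul_pow, mul_pow, ha, hb]; linarith)
    linarith
  have hsinv : s⁻¹ ≤ 162 * a := by
    rw [hs_def, inv_div, div_le_iff₀ hE0]
    calc 18 * c * √(2 * L) ≤ 18 * a ^ 2 * (3 / 2 * b) := by rw [ha]; gcongr
      _ = 162 * a * (a * b / 6) := by ring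
      _ ≤ 162 * a * E := by gcongr
  have e3 : s⁻¹ * (2 * √(2 * L) + 2 * 1) ≤ 162 * a * (4 * (3 / 2 * b)) := by
    refine mul_le_mul hsinv (by linarith) (by positivity) (by positivity)
  -- The total is at most `(3/2 + 1 + 972) a b`, using `2 ≤ a b` for the two constant terms and `162
  -- * 6 = 972`. This is below `1000 a b = 4000 a (b / 4)`.
  have e4 : 4000 * (a * (b / 4)) ≤ 4000 * (a * expMax halfNormal n) := by gcongr
  linarith

theorem eventually_le_sqrt_log (M : ℝ) : ∀ᶠ n : ℕ in atTop, M ≤ √(Real.log n) :=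
  (Real.tendsto_sqrt_atTop.comp
    (Real.tendsto_log_atTop.comp tendsto_natCast_atTop_atTop)).eventually_ge_atTop M

theorem exists_optReward_le :
    ∃ n₀ : ℕ, ∀ n : ℕ, n₀ ≤ n → ∀ c : ℝ, 1 / (400 * √(Real.log n)) ≤ c → c ≤ 1 →
      ∀ σ ∈ mediumNoise halfNormal n c,
        optReward halfNormal σ ≤ 4000 * (√c * expMax halfNormal n) := by
  -- The threshold `2000 = 400 * 5` turns the lower bound on `c` into `c * log n ≥ √(log n) / 400 ≥
  -- 5`.
  obtain ⟨n₀, h⟩ := eventually_atTop.1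
    ((eventually_le_sqrt_log 2000).and (eventually_ge_atTop 100))
  refine ⟨n₀, fun n hn c hc hc1 σ hσ => ?_⟩
  obtain ⟨hL, hn⟩ := h n hn
  have hs0 : 0 < √(Real.log n) := by linarith
  refine optReward_le_of_mem_mediumNoise hn (lt_of_lt_of_le (by positivity) hc) ?_ hc1 hσ
  have hlog : Real.log n = √(Real.log n) * √(Real.log n) :=
    (Real.mul_self_sqrt (Real.sqrt_pos.1 hs0).le).symm
  rw [div_le_iff₀ (by positivity)] at hc
  rw [hlog]; nlinarith

theorem nonempty_mediumNoise {n : ℕ} (hn : 0 < n) {c : ℝ} (hc : c ≤ 1) :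
    (mediumNoise halfNormal n c).Nonempty := by
  have hn1 : (1 : ℝ) ≤ n := by exact_mod_cast hn
  have hle : ⌈(n : ℝ) ^ c⌉₊ ≤ n := Nat.ceil_le.2 (by
    simpa using Real.rpow_le_rpow_of_exponent_le hn1 hc)
  have hpos : 0 < ⌈(n : ℝ) ^ c⌉₊ := Nat.ceil_pos.2 (by positivity)
  set s := expMax halfNormal ⌊(n : ℝ) ^ c⌋₊ / (18 * c * √(2 * Real.log n))
  refine ⟨fun _ => (s + 1).toNNReal, monotone_const, ⟨⌈(n : ℝ) ^ c⌉₊ - 1, by lia⟩,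
    by simp only; lia, ?_⟩
  linarith [Real.le_coe_toNNReal (s + 1)]

theorem exists_forall_policyReward_lt {α : ℝ} (hα : 0 < α) :
    ∃ n₁ : ℕ, ∀ n : ℕ, n₁ ≤ n → ∃ c : ℝ, 1 / (400 * √(Real.log n)) ≤ c ∧ c ≤ 1 ∧
      (mediumNoise halfNormal n c).Nonempty ∧
      ∀ σ ∈ mediumNoise halfNormal n c, ∀ A : Policy n,
        policyReward halfNormal σ A < α * expMax halfNormal n := by
  obtain ⟨n₀, hn₀⟩ := exists_optReward_le
  -- The smallest admissible `c` is used. The level `(5000 / α) ^ 2` forces `√c ≤ α / 5000`, and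
  -- `4000 < 5000` makes the final inequality strict.
  obtain ⟨n₁, h⟩ := eventually_atTop.1 (((eventually_le_sqrt_log 1).and
    (eventually_le_sqrt_log ((5000 / α) ^ 2))).and
      ((eventually_ge_atTop 100).and (eventually_ge_atTop n₀)))
  refine ⟨n₁, fun n hn => ?_⟩
  obtain ⟨⟨h1, hL⟩, h100, hn₀'⟩ := h n hn
  have hs0 : 0 < √(Real.log n) := by linarith
  have hc1 : 1 / (400 * √(Real.log n)) ≤ 1 := by
    rw [div_le_one (by positivity)]; linarith
  refine ⟨1 / (400 * √(Real.log n)), le_rfl, hc1, nonempty_mediumNoise (by lia) hc1,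
    fun σ hσ A => ?_⟩
  have hE : 0 < expMax halfNormal n := lt_of_lt_of_le (by positivity) (sqrt_log_le_expMax h100)
  have hsq : √(1 / (400 * √(Real.log n))) ≤ α / 5000 := by
    refine Real.sqrt_le_iff.2 ⟨by positivity, ?_⟩
    rw [← inv_div 5000 α, inv_pow, one_div]
    exact inv_anti₀ (by positivity) (by linarith)
  calc policyReward halfNormal σ A ≤ optReward halfNormal σ := policyReward_le_optReward σ A
    _ ≤ 4000 * (√(1 / (400 * √(Real.log n))) * expMax halfNormal n) :=
        hn₀ n hn₀' _ le_rfl hc1 σ hσ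
    _ ≤ 4000 * (α / 5000 * expMax halfNormal n) := by gcongr
    _ < α * expMax halfNormal n := by nlinarith [mul_pos hα hE]

end NoisyBoxes

theorem mainTheorem5 :
    -- the half-normal distribution is MHR, and its expected maximum is `ω(E[D])`
    NoisyBoxes.IsMHR NoisyBoxes.halfNormal ∧
    ((fun _ : ℕ => ∫ x, x ∂NoisyBoxes.halfNormal) =o[atTop]
      fun k : ℕ => NoisyBoxes.expMax NoisyBoxes.halfNormal k) ∧
    -- the optimal clairvoyant policy is at least as good as every policy
    (∀ (n : ℕ) (σ : Fin n → ℝ≥0) (A : NoisyBoxes.Policy n),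
      NoisyBoxes.policyReward NoisyBoxes.halfNormal σ A ≤
        NoisyBoxes.optReward NoisyBoxes.halfNormal σ) ∧
    -- under medium noise it earns only `O(√c * E[D_{n:n}])`
    (∃ (C : ℝ) (n₀ : ℕ), ∀ n : ℕ, n₀ ≤ n →
      ∀ c : ℝ, 1 / (400 * √(Real.log n)) ≤ c → c ≤ 1 →
        ∀ σ ∈ NoisyBoxes.mediumNoise NoisyBoxes.halfNormal n c,
          NoisyBoxes.optReward NoisyBoxes.halfNormal σ ≤
            C * (√c * NoisyBoxes.expMax NoisyBoxes.halfNormal n)) ∧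
    -- hence no policy is a constant approximation to the prophet
    (∀ α : ℝ, 0 < α → ∃ n₁ : ℕ, ∀ n : ℕ, n₁ ≤ n →
      ∃ c : ℝ, 1 / (400 * √(Real.log n)) ≤ c ∧ c ≤ 1 ∧
        (NoisyBoxes.mediumNoise NoisyBoxes.halfNormal n c).Nonempty ∧
        ∀ σ ∈ NoisyBoxes.mediumNoise NoisyBoxes.halfNormal n c, ∀ A : NoisyBoxes.Policy n,
          NoisyBoxes.policyReward NoisyBoxes.halfNormal σ A <
            α * NoisyBoxes.expMax NoisyBoxes.halfNormal n) :=
  ⟨NoisyBoxes.isMHR_halfNormal, NoisyBoxes.isLittleO_expMax_halfNormal,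
    fun _ σ A => NoisyBoxes.policyReward_le_optReward σ A,
    ⟨4000, NoisyBoxes.exists_optReward_le⟩,
    fun _ hα => NoisyBoxes.exists_forall_policyReward_lt hα⟩
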